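/- \textbf{Conventions.} All domains below are nonempty posets, and directed sets are nonempty. A \emph{dcpo} is a poset in which every directed subset has a supremum. In a poset, $x\ll y$ means that for every directed set $D$ having a supremum with $\sup D\ge y$ there is $d\in D$ with $x\le d$; $x$ is \emph{compact} if $x\ll x$. A \emph{continuous domain} (resp. \emph{algebraic domain}) is a nonempty dcpo in which, for every $x$, the set $\{y\mid y\ll x\}$ (resp. $\{y\le x\mid y \text{ compact}\}$) is directed with supremum $x$. An \emph{sL-domain} (resp. \emph{L-domain}) is a continuous domain such that for every $x$ the poset ${\downarrow}x=\{y\mid y\le x\}$, with the inherited order, is a sup-semilattice, i.e. any two of its elements have a supremum in it (resp. is a complete lattice). A \emph{bc-domain} is a continuous domain in which every subset having an upper bound has a supremum. An \emph{algebraic sL-domain} (resp. \emph{algebraic L-domain}) is an sL-domain (resp. L-domain) that is an algebraic domain. A map $f$ between dcpos is \emph{Scott continuous} if $f(\sup D)=\sup f(D)$ for every directed $D$. For a binary relation $R$ on a set $U$ and $A\subseteq U$ put $\overline R(A)=\{x\in U\mid \exists y\in A,\ xRy\}$. A \emph{CF-approximation space} is a triple $(U,R,\mathcal F)$ with $R$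 a transitive relation on $U$ and $\mathcal F$ a nonempty family of finite subsets of $U$ such that for every $F\in\mathcal F$ and every finite $K\subseteq\overline R(F)$ there is $G\in\mathcal F$ with $K\subseteq\overline R(G)$ and $G\subseteq\overline R(F)$. It is \emph{topological} if $R$ is a preorder. Let $\mathcal F^\sharp$ be the set of unions of nonempty finite subfamilies of $\mathcal F$. The space is an \emph{sL-approximation space} if for all $M\in\mathcal F^\sharp$ and $F\in\mathcal F$ with $M\subseteq\overline R(F)$ there is $G\in\mathcal F$ such that (1) $\overline R(M)\subseteq\overline R(G)\subseteq\overline R(F)$, and (2) for all $G'\in\mathcal F$, $\overline R(M)\subseteq\overline R(G')\subseteq\overline R(F)$ implies $\overline R(G)\subseteq\overline R(G')$. It is an \emph{L-approximation space} if the same holds for all $M\in\mathcal F^\sharp\cup\{\emptyset\}$. It is a \emph{bc-approximation space} if for all $M\in\mathcal F^\sharp\cup\{\emptyset\}$ and $F\in\mathcal F$ with $M\subseteq\overline R(F)$ there is $G\in\mathcal F$ satisfying (1) and (2$'$) for all $G'\in\mathcal F$, $\overline R(M)\subseteq\overline R(G')$ implies $\overline R(G)\subseteq\overline R(G')$. A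 \emph{CF-approximable relation} from $(U_1,R_1,\mathcal F_1)$ to $(U_2,R_2,\mathcal F_2)$ is a relation $\Theta\subseteq\mathcal F_1\times\mathcal F_2$ such that, for all $F,F'\in\mathcal F_1$ and $G,G',G_1,G_2\in\mathcal F_2$: (i) there is $H\in\mathcal F_2$ with $F\,\Theta\,H$; (ii) if $F\subseteq\overline{R_1}(F')$ and $F\,\Theta\,G$, then $F'\,\Theta\,G$; (iii) if $F\,\Theta\,G$ and $G'\subseteq\overline{R_2}(G)$, then $F\,\Theta\,G'$; (iv) if $F\,\Theta\,G$, there are $F''\in\mathcal F_1$, $G''\in\mathcal F_2$ with $F''\subseteq\overline{R_1}(F)$, $G\subseteq\overline{R_2}(G'')$ and $F''\,\Theta\,G''$; (v) if $F\,\Theta\,G_1$ and $F\,\Theta\,G_2$, there is $G_3\in\mathcal F_2$ with $G_1\cup G_2\subseteq\overline{R_2}(G_3)$ and $F\,\Theta\,G_3$. CF-approximation spaces and CF-approximable relations form a category, with the usual composition of relations, in which the identity of $(U,R,\mathcal F)$ is $\{(F,G)\in\mathcal F\times\mathcal F\mid G\subseteq\overline R(F)\}$. \textbf{Theorem.} The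 category of sL-approximation spaces with CF-approximable relations is equivalent to the category of sL-domains with Scott continuous maps. Likewise, each of the following full subcategories of the category of CF-approximation spaces is equivalent to the indicated category of domains with Scott continuous maps: L-approximation spaces and L-domains; bc-approximation spaces and bc-domains; topological sL-approximation spaces and algebraic sL-domains; topological L-approximation spaces and algebraic L-domains. -/

import Mathlib

open CategoryTheory

universe u

namespace RoughDomain

section Order

/-- `x ≪ y`: every directed (in particular nonempty) set having a supremum above `y` has a member
above `x`. -/
def WayBelow {P : Type u} [PartialOrder P] (x y : P) : Prop :=
  ∀ (D : Set P) (s : P), D.Nonempty → DirectedOn (· ≤ ·) D → IsLUB D s → y ≤ s →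
    ∃ d ∈ D, x ≤ d

/-- Every directed (in particular nonempty) subset has a supremum. -/
def IsDcpo (P : Type u) [PartialOrder P] : Prop :=
  ∀ D : Set P, D.Nonempty → DirectedOn (· ≤ ·) D → ∃ s, IsLUB D s

/-- A continuous poset: each `{y | y ≪ x}` is directed with supremum `x`. -/
def IsContinuousPoset (P : Type u) [PartialOrder P] : Prop :=
  ∀ x : P, {y : P | WayBelow y x}.Nonempty ∧ DirectedOn (· ≤ ·) {y : P | WayBelow y x} ∧
    IsLUB {y : P | WayBelow y x} x

/-- An algebraic poset: the compact elements below each `x` form a directed set with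
supremum `x`. -/
def IsAlgebraicPoset (P : Type u) [PartialOrder P] : Prop :=
  ∀ x : P, {y : P | y ≤ x ∧ IsCompactElement y}.Nonempty ∧
    DirectedOn (· ≤ ·) {y : P | y ≤ x ∧ IsCompactElement y} ∧
    IsLUB {y : P | y ≤ x ∧ IsCompactElement y} x

/-- Every pair of elements has a supremum. -/
def IsSupSemilattice (P : Type u) [PartialOrder P] : Prop :=
  ∀ a b : P, ∃ c, IsLUB {a, b} c

/-- Every subset has a supremum. -/
def IsCompleteLattice (P : Type u) [PartialOrder P] : Prop :=
  ∀ S : Set P, ∃ c, IsLUB S c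

/-- Every subset with an upper bound has a supremum. -/
def IsBcPoset (P : Type u) [PartialOrder P] : Prop :=
  ∀ S : Set P, BddAbove S → ∃ c, IsLUB S c

/-- A continuous domain: a (nonempty) dcpo which is a continuous poset. -/
structure IsContinuousDomain (P : Type u) [PartialOrder P] : Prop where
  nonempty : Nonempty P
  dcpo : IsDcpo P
  continuous : IsContinuousPoset P

/-- An algebraic domain: a (nonempty) dcpo which is an algebraic poset. -/
structure IsAlgebraicDomain (P : Type u) [PartialOrder P] : Prop where
  nonempty : Nonempty P
  dcpo : IsDcpo P
  algebraic : IsAlgebraicPoset P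

/-- A continuous domain all of whose principal ideals, with the inherited order, are
sup-semilattices. -/
structure IsSLDomain (P : Type u) [PartialOrder P] : Prop where
  continuousDomain : IsContinuousDomain P
  principalIdeal : ∀ x : P, IsSupSemilattice (Set.Iic x)

/-- A continuous domain all of whose principal ideals, with the inherited order, are complete
lattices. -/
structure IsLDomain (P : Type u) [PartialOrder P] : Prop where
  continuousDomain : IsContinuousDomain P
  principalIdeal : ∀ x : P, IsCompleteLattice (Set.Iic x)

/-- A continuous domain in which every subset with an upper bound has a supremum. -/
structure IsBcDomain (P : Type u) [PartialOrder P] : Prop where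
  continuousDomain : IsContinuousDomain P
  bcPoset : IsBcPoset P

end Order

section DcpoCategory

/-- A directed complete partially ordered set. -/
structure Dcpo : Type (u + 1) where
  carrier : Type u
  [order : PartialOrder carrier]
  isDcpo : IsDcpo carrier

attribute [instance] Dcpo.order

/-- A Scott continuous map between dcpos. -/
@[ext]
structure ScottHom (L M : Dcpo.{u}) : Type u where
  toFun : L.carrier → M.carrier
  scottContinuous : ScottContinuous toFun

/-- The category of dcpos and Scott continuous maps. -/
instance : Category.{u} Dcpo.{u} where
  Hom := ScottHom
  id L := ⟨id, ScottContinuous.id⟩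
  comp f g := ⟨g.toFun ∘ f.toFun, f.scottContinuous.comp g.scottContinuous⟩

/-- sL-domains, as objects of the category of dcpos. -/
def slDomain : ObjectProperty Dcpo.{u} := fun L => IsSLDomain L.carrier

/-- L-domains. -/
def lDomain : ObjectProperty Dcpo.{u} := fun L => IsLDomain L.carrier

/-- bc-domains. -/
def bcDomain : ObjectProperty Dcpo.{u} := fun L => IsBcDomain L.carrier

/-- Algebraic sL-domains. -/
def algSLDomain : ObjectProperty Dcpo.{u} :=
  fun L => IsAlgebraicDomain L.carrier ∧ IsSLDomain L.carrier

/-- Algebraic L-domains. -/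
def algLDomain : ObjectProperty Dcpo.{u} :=
  fun L => IsAlgebraicDomain L.carrier ∧ IsLDomain L.carrier

/-- The category of sL-domains with Scott continuous maps. -/
abbrev SLDom := (slDomain.{u}).FullSubcategory

/-- The category of L-domains with Scott continuous maps. -/
abbrev LDom := (lDomain.{u}).FullSubcategory

/-- The category of bc-domains with Scott continuous maps. -/
abbrev BcDom := (bcDomain.{u}).FullSubcategory

/-- The category of algebraic sL-domains with Scott continuous maps. -/
abbrev AlgSLDom := (algSLDomain.{u}).FullSubcategory

/-- The category of algebraic L-domains with Scott continuous maps. -/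
abbrev AlgLDom := (algLDomain.{u}).FullSubcategory

end DcpoCategory

section Approximation

/-- The upper approximation operator of a binary relation `R`: the points some `R`-successor of
which lies in `A`. -/
def upperApprox {U : Type u} (R : U → U → Prop) (A : Set U) : Set U :=
  {x | ({y | R x y} ∩ A).Nonempty}

/-- A CF-approximation space `(U, R, 𝓕)`: a set with a transitive relation and a nonempty
consistent family of finite subsets. -/
structure CFSpace : Type (u + 1) where
  carrier : Type u
  rel : carrier → carrier → Prop
  trans : ∀ x y z, rel x y → rel y z → rel x z
  family : Set (Finset carrier)
  family_nonempty : family.Nonempty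
  consistent : ∀ F ∈ family, ∀ K : Finset carrier, (K : Set carrier) ⊆ upperApprox rel F →
    ∃ G ∈ family, (K : Set carrier) ⊆ upperApprox rel G ∧
      (G : Set carrier) ⊆ upperApprox rel F

namespace CFSpace

variable (X : CFSpace.{u})

/-- The upper approximation operator of a CF-approximation space. -/
def upper (A : Set X.carrier) : Set X.carrier := upperApprox X.rel A

/-- The unions of nonempty finite subfamilies of the family `𝓕`. -/
def joinSaturation : Set (Set X.carrier) :=
  {A | ∃ 𝒜 : Set (Finset X.carrier), 𝒜.Finite ∧ 𝒜.Nonempty ∧ 𝒜 ⊆ X.family ∧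
    A = ⋃ F ∈ 𝒜, (F : Set X.carrier)}

/-- The members `G` of `𝓕` for which `upper G` is least among the sets `upper G'`, with `G'` in
`𝓕`, that lie between `upper M` and `upper F`. -/
def relSup (M : Set X.carrier) (F : Finset X.carrier) : Set (Finset X.carrier) :=
  {G | G ∈ X.family ∧ (X.upper M ⊆ X.upper G ∧ X.upper G ⊆ X.upper F) ∧
    ∀ G' ∈ X.family, X.upper M ⊆ X.upper G' → X.upper G' ⊆ X.upper F →
      X.upper G ⊆ X.upper G'}

/-- The members `G` of `𝓕` with `upper M ⊆ upper G ⊆ upper F` for which `upper G` is least among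
all the sets `upper G'`, with `G'` in `𝓕`, that contain `upper M`. -/
def absSup (M : Set X.carrier) (F : Finset X.carrier) : Set (Finset X.carrier) :=
  {G | G ∈ X.family ∧ (X.upper M ⊆ X.upper G ∧ X.upper G ⊆ X.upper F) ∧
    ∀ G' ∈ X.family, X.upper M ⊆ X.upper G' → X.upper G ⊆ X.upper G'}

/-- sL-approximation spaces. -/
def IsSL : Prop :=
  ∀ M ∈ X.joinSaturation, ∀ F ∈ X.family, M ⊆ X.upper F → (X.relSup M F).Nonempty

/-- L-approximation spaces. -/
def IsL : Prop :=
  ∀ M ∈ X.joinSaturation ∪ {∅}, ∀ F ∈ X.family, M ⊆ X.upper F → (X.relSup M F).Nonempty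

/-- bc-approximation spaces. -/
def IsBc : Prop :=
  ∀ M ∈ X.joinSaturation ∪ {∅}, ∀ F ∈ X.family, M ⊆ X.upper F → (X.absSup M F).Nonempty

/-- Topological CF-approximation spaces: the relation is a preorder (it is transitive anyway). -/
def IsTopological : Prop := ∀ x, X.rel x x

variable {X}

/-- A set inside `upper A` has its upper approximation inside `upper A`. -/
theorem upper_subset {A B : Set X.carrier} (h : B ⊆ X.upper A) : X.upper B ⊆ X.upper A := by
  rintro x ⟨y, hxy, hy⟩
  obtain ⟨z, hyz, hz⟩ := h hy
  exact ⟨z, X.trans _ _ _ hxy hyz, hz⟩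

end CFSpace

/-- A CF-approximable relation between CF-approximation spaces. -/
@[ext]
structure CFRel (X Y : CFSpace.{u}) : Type u where
  Rel : X.family → Y.family → Prop
  total : ∀ F, ∃ G, Rel F G
  mono_left : ∀ (F F' : X.family) (G : Y.family),
    (F.1 : Set X.carrier) ⊆ X.upper F'.1 → Rel F G → Rel F' G
  mono_right : ∀ (F : X.family) (G G' : Y.family),
    Rel F G → (G'.1 : Set Y.carrier) ⊆ Y.upper G.1 → Rel F G'
  interpolate : ∀ (F : X.family) (G : Y.family), Rel F G →
    ∃ (F' : X.family) (G' : Y.family), (F'.1 : Set X.carrier) ⊆ X.upper F.1 ∧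
      (G.1 : Set Y.carrier) ⊆ Y.upper G'.1 ∧ Rel F' G'
  directed : ∀ (F : X.family) (G₁ G₂ : Y.family), Rel F G₁ → Rel F G₂ →
    ∃ G₃ : Y.family, (G₁.1 : Set Y.carrier) ∪ G₂.1 ⊆ Y.upper G₃.1 ∧ Rel F G₃

namespace CFRel

/-- The identity CF-approximable relation: `F` is related to `G` when `G ⊆ upper F`. -/
def id (X : CFSpace.{u}) : CFRel X X where
  Rel F G := (G.1 : Set X.carrier) ⊆ X.upper F.1
  total F := by
    obtain ⟨G, hG, -, h⟩ := X.consistent F.1 F.2 ∅ (by simp)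
    exact ⟨⟨G, hG⟩, h⟩
  mono_left F F' G h hG := hG.trans (CFSpace.upper_subset h)
  mono_right F G G' hG h := h.trans (CFSpace.upper_subset hG)
  interpolate F G h := by
    obtain ⟨F', hF', h1, h2⟩ := X.consistent F.1 F.2 G.1 h
    obtain ⟨G', hG', h3, h4⟩ := X.consistent F' hF' G.1 h1
    exact ⟨⟨F', hF'⟩, ⟨G', hG'⟩, h2, h3, h4⟩
  directed F G₁ G₂ h₁ h₂ := by
    classical
    obtain ⟨G, hG, h3, h4⟩ := X.consistent F.1 F.2 (G₁.1 ∪ G₂.1)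
      (by rw [Finset.coe_union]; exact Set.union_subset h₁ h₂)
    exact ⟨⟨G, hG⟩, by rwa [Finset.coe_union] at h3, h4⟩

/-- Composition of CF-approximable relations is the usual composition of relations. -/
def comp {X Y Z : CFSpace.{u}} (Θ : CFRel X Y) (Υ : CFRel Y Z) : CFRel X Z where
  Rel F H := ∃ G, Θ.Rel F G ∧ Υ.Rel G H
  total F := by
    obtain ⟨G, hG⟩ := Θ.total F
    obtain ⟨H, hH⟩ := Υ.total G
    exact ⟨H, G, hG, hH⟩
  mono_left := by
    rintro F F' H h ⟨G, hG, hH⟩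
    exact ⟨G, Θ.mono_left F F' G h hG, hH⟩
  mono_right := by
    rintro F H H' ⟨G, hG, hH⟩ h
    exact ⟨G, hG, Υ.mono_right G H H' hH h⟩
  interpolate := by
    rintro F H ⟨G, hG, hH⟩
    obtain ⟨F', G', h1, h2, h3⟩ := Θ.interpolate F G hG
    obtain ⟨G'', H', h4, h5, h6⟩ := Υ.interpolate G' H (Υ.mono_left G G' H h2 hH)
    exact ⟨F', H', h1, h5, G'', Θ.mono_right F' G' G'' h3 h4, h6⟩
  directed := by
    rintro F H₁ H₂ ⟨G₁, hG₁, hH₁⟩ ⟨G₂, hG₂, hH₂⟩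
    obtain ⟨G, h1, h2⟩ := Θ.directed F G₁ G₂ hG₁ hG₂
    obtain ⟨H, h3, h4⟩ := Υ.directed G H₁ H₂
      (Υ.mono_left G₁ G H₁ (Set.subset_union_left.trans h1) hH₁)
      (Υ.mono_left G₂ G H₂ (Set.subset_union_right.trans h1) hH₂)
    exact ⟨H, h3, G, h2, h4⟩

theorem id_comp {X Y : CFSpace.{u}} (Θ : CFRel X Y) : (CFRel.id X).comp Θ = Θ := by
  ext F H
  constructor
  · rintro ⟨G, hG, hH⟩
    exact Θ.mono_left G F H hG hH
  · intro h
    obtain ⟨F', G', h1, h2, h3⟩ := Θ.interpolate F H h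
    exact ⟨F', h1, Θ.mono_right F' G' H h3 h2⟩

theorem comp_id {X Y : CFSpace.{u}} (Θ : CFRel X Y) : Θ.comp (CFRel.id Y) = Θ := by
  ext F H
  constructor
  · rintro ⟨G, hG, hH⟩
    exact Θ.mono_right F G H hG hH
  · intro h
    obtain ⟨F', G', h1, h2, h3⟩ := Θ.interpolate F H h
    exact ⟨G', Θ.mono_left F' F G' h1 h3, h2⟩

theorem comp_assoc {W X Y Z : CFSpace.{u}} (Θ : CFRel W X) (Υ : CFRel X Y) (Φ : CFRel Y Z) :
    (Θ.comp Υ).comp Φ = Θ.comp (Υ.comp Φ) := by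
  ext F H
  constructor
  · rintro ⟨G, ⟨E, h1, h2⟩, h3⟩
    exact ⟨E, h1, G, h2, h3⟩
  · rintro ⟨E, h1, G, h2, h3⟩
    exact ⟨G, ⟨E, h1, h2⟩, h3⟩

end CFRel

/-- The category of CF-approximation spaces and CF-approximable relations. -/
instance : Category.{u} CFSpace.{u} where
  Hom := CFRel
  id := CFRel.id
  comp := CFRel.comp
  id_comp := CFRel.id_comp
  comp_id := CFRel.comp_id
  assoc := CFRel.comp_assoc

/-- sL-approximation spaces, as objects of the category of CF-approximation spaces. -/
def slApprox : ObjectProperty CFSpace.{u} := fun X => X.IsSL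

/-- L-approximation spaces. -/
def lApprox : ObjectProperty CFSpace.{u} := fun X => X.IsL

/-- bc-approximation spaces. -/
def bcApprox : ObjectProperty CFSpace.{u} := fun X => X.IsBc

/-- Topological sL-approximation spaces. -/
def topSLApprox : ObjectProperty CFSpace.{u} := fun X => X.IsTopological ∧ X.IsSL

/-- Topological L-approximation spaces. -/
def topLApprox : ObjectProperty CFSpace.{u} := fun X => X.IsTopological ∧ X.IsL

/-- The category of sL-approximation spaces with CF-approximable relations. -/
abbrev SLApps := (slApprox.{u}).FullSubcategory

/-- The category of L-approximation spaces with CF-approximable relations. -/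
abbrev LApps := (lApprox.{u}).FullSubcategory

/-- The category of bc-approximation spaces with CF-approximable relations. -/
abbrev BcApps := (bcApprox.{u}).FullSubcategory

/-- The category of topological sL-approximation spaces with CF-approximable relations. -/
abbrev TopSLApps := (topSLApprox.{u}).FullSubcategory

/-- The category of topological L-approximation spaces with CF-approximable relations. -/
abbrev TopLApps := (topLApprox.{u}).FullSubcategory

end Approximation

end RoughDomain

namespace RoughDomain

/-! ### CF-closed sets. -/

namespace CFSpace

variable {X : CFSpace.{u}}

/-! All five equivalences are restrictions of one fully faithful functor, `closedSetFunctor`, which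
sends a space to its CF-closed sets ordered by inclusion. Such a set `E` is the directed union of
the sets `upper F`, with `F` in the family and `F ⊆ E`. Since `F` is finite, it lies in a directed
union only if it lies in one of the united sets. Hence `upper F` is way below `E`, and the poset is
a continuous domain (`isContinuousDomain_closedSet`).

Full faithfulness: a Scott continuous map is determined by its values on the sets `upper F`, and
each value by the members `G` of the family that it contains. The relation `G ⊆ f (upper F)` thus
encodes `f`, and the axioms of a CF-approximable relation are what decoding requires
(`subset_map_principal_iff`, `map_ofScottContinuous`).

Objects go to the right class because suprema below `E` are glued from suprema in the family: the
supremum of `S` is the union of the sets `upper G`, where `G` is a relative supremum, inside some `F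
⊆ E`, of a finite union of family members lying in elements of `S`. The key point is that such a
relative supremum does not depend on the bound `F` (`upper_subset_of_mem_relSup`).

Essential surjectivity: a basis `B` of a domain, with the way-below relation and the singletons as
family, is a space whose CF-closed sets are the rounded ideals of `B`; taking suprema identifies
these with the domain (`closedSetOrderIso`). The whole domain serves as `B` in general. In the
algebraic cases `B` consists of the compact elements, so that the relation is reflexive. -/

theorem upper_mono {A B : Set X.carrier} (h : A ⊆ B) : X.upper A ⊆ X.upper B :=
  fun _ ⟨y, hxy, hy⟩ => ⟨y, hxy, h hy⟩

/-- A set is CF-closed if every finite subset lies in the upper approximation of some member of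
the family whose upper approximation lies in the set. -/
def IsCFClosed (E : Set X.carrier) : Prop :=
  ∀ K : Finset X.carrier, (K : Set X.carrier) ⊆ E →
    ∃ F ∈ X.family, (K : Set X.carrier) ⊆ X.upper F ∧ X.upper F ⊆ E

theorem IsCFClosed.upper_subset {E : Set X.carrier} (hE : IsCFClosed E) : X.upper E ⊆ E := by
  rintro x ⟨y, hxy, hy⟩
  obtain ⟨F, -, h1, h2⟩ := hE {y} (by simpa using hy)
  exact h2 (CFSpace.upper_subset h1 ⟨y, hxy, by simp⟩)

theorem IsCFClosed.upper_subset_of_subset {E A : Set X.carrier} (hE : IsCFClosed E) (h : A ⊆ E) :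
    X.upper A ⊆ E :=
  (upper_mono h).trans hE.upper_subset

/-- Closedness bounds `upper F` but not `F`, since the relation need not be reflexive. One
application of consistency replaces `F` by a member inside `upper F`. -/
theorem IsCFClosed.exists_subset {E A : Set X.carrier} (hE : IsCFClosed E) (hA : A.Finite)
    (h : A ⊆ E) : ∃ F ∈ X.family, A ⊆ X.upper F ∧ (F : Set X.carrier) ⊆ E := by
  obtain ⟨F, hF, h1, h2⟩ := hE hA.toFinset (by simpa using h)
  obtain ⟨G, hG, h3, h4⟩ := X.consistent F hF _ h1
  rw [hA.coe_toFinset] at h3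
  exact ⟨G, hG, h3, h4.trans h2⟩

theorem isCFClosed_upper {F : Finset X.carrier} (hF : F ∈ X.family) : IsCFClosed (X.upper F) :=
  fun _ hK => ⟨F, hF, hK, subset_rfl⟩

theorem IsCFClosed.sUnion {D : Set (Set X.carrier)} (hD : D.Nonempty)
    (hdir : DirectedOn (· ⊆ ·) D) (h : ∀ E ∈ D, IsCFClosed E) : IsCFClosed (⋃₀ D) := by
  intro K hK
  rw [Set.sUnion_eq_biUnion] at hK
  obtain ⟨E, hE, hKE⟩ := DirectedOn.exists_mem_subset_of_finset_subset_biUnion hD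
    (f := fun E => E) hdir hK
  obtain ⟨F, hF, h1, h2⟩ := h E hE K hKE
  exact ⟨F, hF, h1, h2.trans (Set.subset_sUnion_of_mem hE)⟩

/-! ### The continuous domain of CF-closed sets. -/

variable (X) in
/-- The poset of CF-closed sets. -/
abbrev ClosedSet : Type u := {E : Set X.carrier // IsCFClosed E}

/-- The upper approximation of a member of the family, as a CF-closed set. -/
def principal (F : X.family) : X.ClosedSet := ⟨X.upper F.1, isCFClosed_upper F.2⟩

theorem principal_le_of_subset {F : X.family} {E : X.ClosedSet}
    (h : (F.1 : Set X.carrier) ⊆ E.1) : principal F ≤ E :=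
  E.2.upper_subset_of_subset h

/-- The union of a directed set of CF-closed sets. -/
def directedUnion (D : Set X.ClosedSet) (hD : D.Nonempty) (hdir : DirectedOn (· ≤ ·) D) :
    X.ClosedSet :=
  ⟨⋃₀ (Subtype.val '' D), IsCFClosed.sUnion (hD.image _)
    (by
      rintro _ ⟨a, ha, rfl⟩ _ ⟨b, hb, rfl⟩
      obtain ⟨c, hc, hac, hbc⟩ := hdir a ha b hb
      exact ⟨c.1, ⟨c, hc, rfl⟩, hac, hbc⟩)
    (by rintro _ ⟨a, -, rfl⟩; exact a.2)⟩

theorem isLUB_directedUnion (D : Set X.ClosedSet) (hD : D.Nonempty)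
    (hdir : DirectedOn (· ≤ ·) D) : IsLUB D (directedUnion D hD hdir) :=
  ⟨fun E hE => Set.subset_sUnion_of_mem ⟨E, hE, rfl⟩, fun B hB =>
    Set.sUnion_subset (by rintro _ ⟨E, hE, rfl⟩; exact hB hE)⟩

theorem isDcpo_closedSet : IsDcpo X.ClosedSet :=
  fun D hD hdir => ⟨_, isLUB_directedUnion D hD hdir⟩

theorem mem_iff_of_isLUB {D : Set X.ClosedSet} (hD : D.Nonempty) (hdir : DirectedOn (· ≤ ·) D)
    {E : X.ClosedSet} (h : IsLUB D E) {x : X.carrier} : x ∈ E.1 ↔ ∃ A ∈ D, x ∈ A.1 := by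
  rw [h.unique (isLUB_directedUnion D hD hdir)]
  simp [directedUnion]

/-- The principal CF-closed sets generated by the members of the family inside `E`. -/
def approximants (E : X.ClosedSet) : Set X.ClosedSet :=
  {A | ∃ F : X.family, (F.1 : Set X.carrier) ⊆ E.1 ∧ A = principal F}

theorem approximants_nonempty (E : X.ClosedSet) : (approximants E).Nonempty := by
  obtain ⟨F, hF, -, h⟩ := E.2.exists_subset Set.finite_empty (Set.empty_subset _)
  exact ⟨_, ⟨F, hF⟩, h, rfl⟩

theorem approximants_directedOn (E : X.ClosedSet) : DirectedOn (· ≤ ·) (approximants E) := by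
  rintro _ ⟨F, hF, rfl⟩ _ ⟨G, hG, rfl⟩
  obtain ⟨H, hH, h1, h2⟩ := E.2.exists_subset (F.1.finite_toSet.union G.1.finite_toSet)
    (Set.union_subset hF hG)
  exact ⟨_, ⟨⟨H, hH⟩, h2, rfl⟩,
    CFSpace.upper_subset (Set.subset_union_left.trans h1),
    CFSpace.upper_subset (Set.subset_union_right.trans h1)⟩

theorem isLUB_approximants (E : X.ClosedSet) : IsLUB (approximants E) E := by
  constructor
  · rintro _ ⟨F, hF, rfl⟩
    exact principal_le_of_subset hF
  · intro B hB x hx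
    obtain ⟨F, hF, h1, h2⟩ := E.2.exists_subset (Set.finite_singleton x) (by simpa using hx)
    exact hB ⟨⟨F, hF⟩, h2, rfl⟩ (h1 rfl)

theorem exists_subset_of_isLUB {D : Set X.ClosedSet} (hD : D.Nonempty)
    (hdir : DirectedOn (· ≤ ·) D) {E : X.ClosedSet} (h : IsLUB D E) {F : Finset X.carrier}
    (hF : (F : Set X.carrier) ⊆ E.1) : ∃ A ∈ D, (F : Set X.carrier) ⊆ A.1 :=
  DirectedOn.exists_mem_subset_of_finset_subset_biUnion hD (f := Subtype.val) hdir fun x hx => by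
    simpa using (mem_iff_of_isLUB hD hdir h).1 (hF hx)

/-- The approximants form a directed set with supremum `E`, which gives one direction. For the
other, a finite `F` inside a directed union already lies in one of its members. -/
theorem wayBelow_closedSet_iff {A E : X.ClosedSet} :
    WayBelow A E ↔ ∃ B ∈ approximants E, A ≤ B := by
  constructor
  · exact fun h => h _ E (approximants_nonempty E) (approximants_directedOn E)
      (isLUB_approximants E) le_rfl
  · rintro ⟨_, ⟨F, hF, rfl⟩, hA⟩ D s hD hdir hs hE
    obtain ⟨B, hB, hFB⟩ := exists_subset_of_isLUB hD hdir hs (hF.trans hE)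
    exact ⟨B, hB, hA.trans (principal_le_of_subset hFB)⟩

theorem isContinuousDomain_closedSet : IsContinuousDomain X.ClosedSet where
  nonempty := X.family_nonempty.elim fun F hF => ⟨principal ⟨F, hF⟩⟩
  dcpo := isDcpo_closedSet
  continuous E := by
    have hsub : approximants E ⊆ {A | WayBelow A E} := fun A hA =>
      wayBelow_closedSet_iff.2 ⟨A, hA, le_rfl⟩
    refine ⟨(approximants_nonempty E).mono hsub, fun A hA B hB => ?_, fun A hA => ?_,
      fun B hB => (isLUB_approximants E).2 fun A hA => hB (hsub hA)⟩
    · obtain ⟨A', hA', hAA'⟩ := wayBelow_closedSet_iff.1 hA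
      obtain ⟨B', hB', hBB'⟩ := wayBelow_closedSet_iff.1 hB
      obtain ⟨C, hC, h1, h2⟩ := approximants_directedOn E A' hA' B' hB'
      exact ⟨C, hsub hC, hAA'.trans h1, hBB'.trans h2⟩
    · obtain ⟨A', hA', hAA'⟩ := wayBelow_closedSet_iff.1 hA
      exact hAA'.trans ((isLUB_approximants E).1 hA')

/-- A CF-closed set is the supremum of its approximants, and these depend only on the family members
it contains. -/
theorem closedSet_ext {E E' : X.ClosedSet}
    (h : ∀ F : X.family, (F.1 : Set X.carrier) ⊆ E.1 ↔ (F.1 : Set X.carrier) ⊆ E'.1) :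
    E = E' := by
  have : approximants E = approximants E' := by
    ext A
    simp only [approximants, Set.mem_ofPred_eq, h]
  exact (isLUB_approximants E).unique (this ▸ isLUB_approximants E')

theorem IsTopological.subset_upper (h : X.IsTopological) (A : Set X.carrier) : A ⊆ X.upper A :=
  fun x hx => ⟨x, h x, hx⟩

theorem IsTopological.isAlgebraicDomain_closedSet (h : X.IsTopological) :
    IsAlgebraicDomain X.ClosedSet where
  nonempty := isContinuousDomain_closedSet.nonempty
  dcpo := isDcpo_closedSet
  algebraic E := by
    have hsub : approximants E ⊆ {A | A ≤ E ∧ IsCompactElement A} := by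
      rintro _ ⟨F, hF, rfl⟩
      -- Reflexivity puts `F` inside `upper F`, so the principal set is one of its own approximants
      -- and hence compact.
      exact ⟨principal_le_of_subset hF, wayBelow_closedSet_iff.2
        ⟨_, ⟨F, h.subset_upper _, rfl⟩, le_rfl⟩⟩
    have hbelow : ∀ A ∈ {A : X.ClosedSet | A ≤ E ∧ IsCompactElement A},
        ∃ B ∈ approximants E, A ≤ B := fun A hA =>
      hA.2 _ E (approximants_nonempty E) (approximants_directedOn E) (isLUB_approximants E) hA.1
    refine ⟨(approximants_nonempty E).mono hsub, fun A hA B hB => ?_, fun A hA => hA.1,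
      fun B hB => (isLUB_approximants E).2 fun A hA => hB (hsub hA)⟩
    obtain ⟨A', hA', hAA'⟩ := hbelow A hA
    obtain ⟨B', hB', hBB'⟩ := hbelow B hB
    obtain ⟨C, hC, h1, h2⟩ := approximants_directedOn E A' hA' B' hB'
    exact ⟨C, hsub hC, hAA'.trans h1, hBB'.trans h2⟩

/-! ### Gluing relative suprema of the family. -/

section LocalSup

/-- Enlarging the bound does not change a relative supremum: a supremum `H` inside `F'` is below
`G`, hence inside `F`, where minimality of `G` puts `G` below `H`. So `G` is also below every
competitor inside `F'`. -/
theorem upper_subset_of_mem_relSup {M : Set X.carrier} {F F' G G' : Finset X.carrier}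
    (hG : G ∈ X.relSup M F) (hG' : G' ∈ X.family) (hMG' : X.upper M ⊆ X.upper G')
    (hFF' : X.upper F ⊆ X.upper F') (hG'F' : X.upper G' ⊆ X.upper F')
    (hne : (X.relSup M F').Nonempty) : X.upper G ⊆ X.upper G' := by
  obtain ⟨H, hH, ⟨h1, -⟩, h3⟩ := hne
  obtain ⟨hGm, ⟨h4, h5⟩, h6⟩ := hG
  have hHG := h3 G hGm h4 (h5.trans hFF')
  exact (h6 H hH h1 (hHG.trans h5)).trans (h3 G' hG' hMG' hG'F')

theorem absSup_subset_relSup (M : Set X.carrier) (F : Finset X.carrier) :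
    X.absSup M F ⊆ X.relSup M F :=
  fun _ hG => ⟨hG.1, hG.2.1, fun G' hG' h _ => hG.2.2 G' hG' h⟩

/-- The sets `upper G`, where `G` is a relative supremum of a member of `𝒜` inside some member of
the family contained in `E`. -/
def localSups (𝒜 : Set (Set X.carrier)) (E : Set X.carrier) : Set (Set X.carrier) :=
  {A | ∃ M ∈ 𝒜, ∃ F ∈ X.family, (F : Set X.carrier) ⊆ E ∧ M ⊆ X.upper F ∧
    ∃ G ∈ X.relSup M F, A = X.upper G}

variable {𝒜 : Set (Set X.carrier)} {E : Set X.carrier}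

theorem localSups_nonempty (h𝒜 : 𝒜.Nonempty) (hE : IsCFClosed E)
    (hfin : ∀ M ∈ 𝒜, M.Finite ∧ M ⊆ E)
    (hsup : ∀ M ∈ 𝒜, ∀ F ∈ X.family, M ⊆ X.upper F → (X.relSup M F).Nonempty) :
    (localSups 𝒜 E).Nonempty := by
  obtain ⟨M, hM⟩ := h𝒜
  obtain ⟨F, hF, h1, h2⟩ := hE.exists_subset (hfin M hM).1 (hfin M hM).2
  obtain ⟨G, hG⟩ := hsup M hM F hF h1
  exact ⟨_, M, hM, F, hF, h2, h1, G, hG, rfl⟩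

/-- Suprema taken inside `F` and `F'` are compared inside a common bound `H`, chosen to cover `F`,
`F'` and a set `N` dominating both `M` and `M'`. -/
theorem localSups_directedOn (hE : IsCFClosed E)
    (hdir : DirectedOn (fun A B => A ⊆ X.upper B) 𝒜) (hfin : ∀ M ∈ 𝒜, M.Finite ∧ M ⊆ E)
    (hsup : ∀ M ∈ 𝒜, ∀ F ∈ X.family, M ⊆ X.upper F → (X.relSup M F).Nonempty) :
    DirectedOn (· ⊆ ·) (localSups 𝒜 E) := by
  rintro _ ⟨M, hM, F, hF, hFE, hMF, G, hG, rfl⟩ _ ⟨M', hM', F', hF', hFE', hMF', G', hG', rfl⟩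
  obtain ⟨N, hN, hMN, hMN'⟩ := hdir M hM M' hM'
  obtain ⟨H, hH, h1, h2⟩ := hE.exists_subset
    (((hfin N hN).1.union F.finite_toSet).union F'.finite_toSet)
    (Set.union_subset (Set.union_subset (hfin N hN).2 hFE) hFE')
  simp only [Set.union_subset_iff] at h1
  obtain ⟨⟨hNH, hFH⟩, hFH'⟩ := h1
  obtain ⟨K, hK⟩ := hsup N hN H hH hNH
  have hFH := CFSpace.upper_subset hFH
  have hFH' := CFSpace.upper_subset hFH'
  exact ⟨_, ⟨N, hN, H, hH, h2, hNH, K, hK, rfl⟩,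
    upper_subset_of_mem_relSup hG hK.1 ((CFSpace.upper_subset hMN).trans hK.2.1.1) hFH hK.2.1.2
      (hsup M hM H hH (hMF.trans hFH)),
    upper_subset_of_mem_relSup hG' hK.1 ((CFSpace.upper_subset hMN').trans hK.2.1.1) hFH' hK.2.1.2
      (hsup M' hM' H hH (hMF'.trans hFH'))⟩

theorem isCFClosed_sUnion_localSups (h𝒜 : 𝒜.Nonempty) (hE : IsCFClosed E)
    (hdir : DirectedOn (fun A B => A ⊆ X.upper B) 𝒜) (hfin : ∀ M ∈ 𝒜, M.Finite ∧ M ⊆ E)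
    (hsup : ∀ M ∈ 𝒜, ∀ F ∈ X.family, M ⊆ X.upper F → (X.relSup M F).Nonempty) :
    IsCFClosed (⋃₀ localSups 𝒜 E) :=
  IsCFClosed.sUnion (localSups_nonempty h𝒜 hE hfin hsup) (localSups_directedOn hE hdir hfin hsup)
    (by rintro _ ⟨M, hM, F, hF, hFE, hMF, G, hG, rfl⟩; exact isCFClosed_upper hG.1)

theorem sUnion_localSups_subset (hE : IsCFClosed E) : ⋃₀ localSups 𝒜 E ⊆ E := by
  refine Set.sUnion_subset ?_
  rintro _ ⟨M, hM, F, hF, hFE, hMF, G, hG, rfl⟩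
  exact hG.2.1.2.trans (hE.upper_subset_of_subset hFE)

theorem upper_subset_sUnion_localSups (hE : IsCFClosed E) (hfin : ∀ M ∈ 𝒜, M.Finite ∧ M ⊆ E)
    (hsup : ∀ M ∈ 𝒜, ∀ F ∈ X.family, M ⊆ X.upper F → (X.relSup M F).Nonempty)
    {M : Set X.carrier} (hM : M ∈ 𝒜) : X.upper M ⊆ ⋃₀ localSups 𝒜 E := by
  obtain ⟨F, hF, h1, h2⟩ := hE.exists_subset (hfin M hM).1 (hfin M hM).2
  obtain ⟨G, hG⟩ := hsup M hM F hF h1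
  exact hG.2.1.1.trans (Set.subset_sUnion_of_mem ⟨M, hM, F, hF, h2, h1, G, hG, rfl⟩)

/-- A member `K` inside `H` covers `M` but need not lie under the bound `F`. Both fit under some `F'
⊆ E`, and independence of the bound applies there; this is where `H ⊆ E` enters. -/
theorem sUnion_localSups_subset_of_subset (hE : IsCFClosed E)
    (hfin : ∀ M ∈ 𝒜, M.Finite ∧ M ⊆ E)
    (hsup : ∀ M ∈ 𝒜, ∀ F ∈ X.family, M ⊆ X.upper F → (X.relSup M F).Nonempty)
    {H : Set X.carrier} (hH : IsCFClosed H) (hHE : H ⊆ E) (hMH : ∀ M ∈ 𝒜, M ⊆ H) :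
    ⋃₀ localSups 𝒜 E ⊆ H := by
  refine Set.sUnion_subset ?_
  rintro _ ⟨M, hM, F, hF, hFE, hMF, G, hG, rfl⟩
  obtain ⟨K, hK, h1, h2⟩ := hH.exists_subset (hfin M hM).1 (hMH M hM)
  obtain ⟨F', hF', h3, h4⟩ := hE.exists_subset (F.finite_toSet.union K.finite_toSet)
    (Set.union_subset hFE (h2.trans hHE))
  have h5 := CFSpace.upper_subset (Set.subset_union_left.trans h3)
  exact (upper_subset_of_mem_relSup hG hK (CFSpace.upper_subset h1) h5
    (CFSpace.upper_subset (Set.subset_union_right.trans h3))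
    (hsup M hM F' hF' (hMF.trans h5))).trans (hH.upper_subset_of_subset h2)

/-- A relative supremum lies below the absolute one, which is below every family member covering
`M`. No common bound is needed, so `H` need not lie in `E`. -/
theorem sUnion_localSups_subset_of_absSup
    (hfin : ∀ M ∈ 𝒜, M.Finite ∧ M ⊆ E)
    (hsup : ∀ M ∈ 𝒜, ∀ F ∈ X.family, M ⊆ X.upper F → (X.absSup M F).Nonempty)
    {H : Set X.carrier} (hH : IsCFClosed H) (hMH : ∀ M ∈ 𝒜, M ⊆ H) :
    ⋃₀ localSups 𝒜 E ⊆ H := by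
  refine Set.sUnion_subset ?_
  rintro _ ⟨M, hM, F, hF, hFE, hMF, G, hG, rfl⟩
  obtain ⟨K, hK, h1, h2⟩ := hH.exists_subset (hfin M hM).1 (hMH M hM)
  obtain ⟨L, hL, h3, h4⟩ := hsup M hM F hF hMF
  exact ((hG.2.2 L hL h3.1 h3.2).trans (h4 K hK (CFSpace.upper_subset h1))).trans
    (hH.upper_subset_of_subset h2)

end LocalSup

/-! ### Suprema of sets of CF-closed sets. -/

section Suprema

/-- Unions of nonempty finite subfamilies of the family, each member of which lies in an element
of `S`. -/
def joinApproximants (S : Set X.ClosedSet) : Set (Set X.carrier) :=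
  {M | ∃ 𝒢 : Set (Finset X.carrier), 𝒢.Finite ∧ 𝒢.Nonempty ∧
    (∀ F ∈ 𝒢, F ∈ X.family ∧ ∃ A ∈ S, (F : Set X.carrier) ⊆ A.1) ∧
    M = ⋃ F ∈ 𝒢, (F : Set X.carrier)}

variable {S : Set X.ClosedSet}

theorem joinApproximants_subset_joinSaturation : joinApproximants S ⊆ X.joinSaturation := by
  rintro _ ⟨𝒢, h1, h2, h3, rfl⟩
  exact ⟨𝒢, h1, h2, fun F hF => (h3 F hF).1, rfl⟩

theorem finite_of_mem_joinApproximants {M : Set X.carrier} (hM : M ∈ joinApproximants S) :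
    M.Finite := by
  obtain ⟨𝒢, h1, -, -, rfl⟩ := hM
  exact h1.biUnion fun F _ => F.finite_toSet

theorem subset_of_mem_joinApproximants {M : Set X.carrier} (hM : M ∈ joinApproximants S)
    {E : X.ClosedSet} (hE : E ∈ upperBounds S) : M ⊆ E.1 := by
  obtain ⟨𝒢, -, -, h3, rfl⟩ := hM
  refine Set.iUnion₂_subset fun F hF => ?_
  obtain ⟨-, A, hA, hFA⟩ := h3 F hF
  exact hFA.trans (hE hA)

theorem coe_mem_joinApproximants {F : Finset X.carrier} (hF : F ∈ X.family) {A : X.ClosedSet}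
    (hA : A ∈ S) (hFA : (F : Set X.carrier) ⊆ A.1) :
    (F : Set X.carrier) ∈ joinApproximants S :=
  ⟨{F}, Set.finite_singleton F, Set.singleton_nonempty F,
    by rintro _ rfl; exact ⟨hF, A, hA, hFA⟩, by simp⟩

theorem joinApproximants_nonempty (hS : S.Nonempty) : (joinApproximants S).Nonempty := by
  obtain ⟨A, hA⟩ := hS
  obtain ⟨F, hF, -, h⟩ := A.2.exists_subset Set.finite_empty (Set.empty_subset _)
  exact ⟨_, coe_mem_joinApproximants hF hA h⟩

/-- `S` need not be directed: each `F` is enlarged to some `G` within the same element of `S`, and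
the union of all these `G` is again admissible. -/
theorem joinApproximants_directedOn :
    DirectedOn (fun A B => A ⊆ X.upper B) (joinApproximants S) := by
  rintro _ ⟨𝒢, h1, h2, h3, rfl⟩ _ ⟨ℋ, h4, -, h6, rfl⟩
  have h7 : ∀ F ∈ 𝒢 ∪ ℋ, ∃ G : Finset X.carrier, (G ∈ X.family ∧
      ∃ A ∈ S, (G : Set X.carrier) ⊆ A.1) ∧ (F : Set X.carrier) ⊆ X.upper G := by
    intro F hF
    obtain ⟨-, A, hA, hFA⟩ := hF.elim (h3 F) (h6 F)
    obtain ⟨G, hG, h8, h9⟩ := A.2.exists_subset F.finite_toSet hFA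
    exact ⟨G, ⟨hG, A, hA, h9⟩, h8⟩
  choose! g hg hFg using h7
  have h10 : ∀ F ∈ 𝒢 ∪ ℋ, (F : Set X.carrier) ⊆
      X.upper (⋃ G ∈ g '' (𝒢 ∪ ℋ), (G : Set X.carrier)) := fun F hF =>
    (hFg F hF).trans (upper_mono (Set.subset_biUnion_of_mem (u := fun G : Finset X.carrier =>
      (G : Set X.carrier)) (Set.mem_image_of_mem g hF)))
  refine ⟨_, ⟨g '' (𝒢 ∪ ℋ), (h1.union h4).image g, (h2.inl).image g, ?_, rfl⟩,
    Set.iUnion₂_subset fun F hF => h10 F (Or.inl hF),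
    Set.iUnion₂_subset fun F hF => h10 F (Or.inr hF)⟩
  rintro _ ⟨F, hF, rfl⟩
  exact hg F hF

theorem le_of_upper_subset_of_mem {B : X.ClosedSet}
    (h : ∀ M ∈ joinApproximants S, X.upper M ⊆ B.1) : B ∈ upperBounds S := by
  intro A hA x hx
  obtain ⟨F, hF, h1, h2⟩ := A.2.exists_subset (Set.finite_singleton x) (by simpa using hx)
  exact h _ (coe_mem_joinApproximants hF hA h2) (h1 rfl)

/-- The supremum is the union of `localSups`. The index family is `joinApproximants S` when `S` is
nonempty. For empty `S` it is `{∅}`, and relative suprema of `∅` must be assumed because the sL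
condition does not supply them. -/
theorem exists_local_isLUB {E : X.ClosedSet} (hSE : E ∈ upperBounds S)
    (hS : S.Nonempty ∨ ∀ F ∈ X.family, (X.relSup ∅ F).Nonempty) (hX : X.IsSL) :
    ∃ C ≤ E, C ∈ upperBounds S ∧ ∀ B ≤ E, B ∈ upperBounds S → C ≤ B := by
  rcases S.eq_empty_or_nonempty with rfl | hne
  · have hbot : ∀ F ∈ X.family, (X.relSup ∅ F).Nonempty := by simpa using hS
    have hfin : ∀ M ∈ ({∅} : Set (Set X.carrier)), M.Finite ∧ M ⊆ E.1 := by simp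
    have hsup : ∀ M ∈ ({∅} : Set (Set X.carrier)), ∀ F ∈ X.family, M ⊆ X.upper F →
        (X.relSup M F).Nonempty := by
      rintro _ rfl F hF -
      exact hbot F hF
    exact ⟨⟨_, isCFClosed_sUnion_localSups (Set.singleton_nonempty ∅) E.2
        (by rintro _ rfl _ rfl; exact ⟨∅, rfl, by simp⟩) hfin hsup⟩, sUnion_localSups_subset E.2, by simp,
      fun B hB _ => sUnion_localSups_subset_of_subset E.2 hfin hsup B.2 hB (by simp)⟩
  · have hfin : ∀ M ∈ joinApproximants S, M.Finite ∧ M ⊆ E.1 := fun M hM =>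
      ⟨finite_of_mem_joinApproximants hM, subset_of_mem_joinApproximants hM hSE⟩
    have hsup : ∀ M ∈ joinApproximants S, ∀ F ∈ X.family, M ⊆ X.upper F →
        (X.relSup M F).Nonempty := fun M hM => hX M (joinApproximants_subset_joinSaturation hM)
    exact ⟨⟨_, isCFClosed_sUnion_localSups (joinApproximants_nonempty hne) E.2
        joinApproximants_directedOn hfin hsup⟩, sUnion_localSups_subset E.2,
      le_of_upper_subset_of_mem fun M hM => upper_subset_sUnion_localSups E.2 hfin hsup hM,
      fun B hB hBS => sUnion_localSups_subset_of_subset E.2 hfin hsup B.2 hB fun M hM =>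
        subset_of_mem_joinApproximants hM hBS⟩

theorem IsL.isSL (hX : X.IsL) : X.IsSL := fun M hM => hX M (Or.inl hM)

theorem IsBc.isBcPoset_closedSet (hX : X.IsBc) : IsBcPoset X.ClosedSet := by
  rintro S ⟨E, hSE⟩
  rcases S.eq_empty_or_nonempty with rfl | hne
  · have hfin : ∀ M ∈ ({∅} : Set (Set X.carrier)), M.Finite ∧ M ⊆ E.1 := by simp
    have hsup : ∀ M ∈ ({∅} : Set (Set X.carrier)), ∀ F ∈ X.family, M ⊆ X.upper F →
        (X.absSup M F).Nonempty := fun M hM => hX M (Or.inr hM)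
    have hsup' := fun M hM F hF h => (hsup M hM F hF h).mono (absSup_subset_relSup M F)
    exact ⟨⟨_, isCFClosed_sUnion_localSups (Set.singleton_nonempty ∅) E.2
        (by rintro _ rfl _ rfl; exact ⟨∅, rfl, by simp⟩) hfin hsup'⟩, by simp,
      fun B _ => sUnion_localSups_subset_of_absSup hfin hsup B.2 (by simp)⟩
  · have hfin : ∀ M ∈ joinApproximants S, M.Finite ∧ M ⊆ E.1 := fun M hM =>
      ⟨finite_of_mem_joinApproximants hM, subset_of_mem_joinApproximants hM hSE⟩
    have hsup : ∀ M ∈ joinApproximants S, ∀ F ∈ X.family, M ⊆ X.upper F →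
        (X.absSup M F).Nonempty := fun M hM =>
      hX M (Or.inl (joinApproximants_subset_joinSaturation hM))
    have hsup' := fun M hM F hF h => (hsup M hM F hF h).mono (absSup_subset_relSup M F)
    exact ⟨⟨_, isCFClosed_sUnion_localSups (joinApproximants_nonempty hne) E.2
        joinApproximants_directedOn hfin hsup'⟩,
      le_of_upper_subset_of_mem fun M hM => upper_subset_sUnion_localSups E.2 hfin hsup' hM,
      fun B hBS => sUnion_localSups_subset_of_absSup hfin hsup B.2 fun M hM =>
        subset_of_mem_joinApproximants hM hBS⟩

end Suprema

end CFSpace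

/-! ### Principal ideals and the resulting classes of domains. -/

section PrincipalIdeal

variable {P : Type u} [PartialOrder P]

/-- Suprema in a principal ideal, expressed in the ambient poset. -/
theorem exists_isLUB_Iic_iff {x : P} {S : Set (Set.Iic x)} :
    (∃ c, IsLUB S c) ↔ ∃ c ≤ x, c ∈ upperBounds (Subtype.val '' S) ∧
      ∀ b ≤ x, b ∈ upperBounds (Subtype.val '' S) → c ≤ b := by
  constructor
  · rintro ⟨c, h1, h2⟩
    refine ⟨c.1, c.2, ?_, fun b hb hS => h2 (?_ : (⟨b, hb⟩ : Set.Iic x) ∈ upperBounds S)⟩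
    · rintro _ ⟨a, ha, rfl⟩
      exact h1 ha
    · exact fun a ha => hS ⟨a, ha, rfl⟩
  · rintro ⟨c, hc, h1, h2⟩
    refine ⟨⟨c, hc⟩, fun a ha => h1 ⟨a, ha, rfl⟩, fun b hb => h2 b.1 b.2 ?_⟩
    rintro _ ⟨a, ha, rfl⟩
    exact hb ha

theorem mem_upperBounds_image_val {x : P} (S : Set (Set.Iic x)) :
    x ∈ upperBounds (Subtype.val '' S) := by
  rintro _ ⟨a, -, rfl⟩
  exact a.2

end PrincipalIdeal

namespace CFSpace

variable {X : CFSpace.{u}}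

theorem IsSL.isSLDomain_closedSet (hX : X.IsSL) : IsSLDomain X.ClosedSet where
  continuousDomain := isContinuousDomain_closedSet
  principalIdeal _ a b := exists_isLUB_Iic_iff.2
    (exists_local_isLUB (mem_upperBounds_image_val _) (Or.inl ⟨a.1, a, by simp, rfl⟩) hX)

theorem IsL.isLDomain_closedSet (hX : X.IsL) : IsLDomain X.ClosedSet where
  continuousDomain := isContinuousDomain_closedSet
  principalIdeal _ _ := exists_isLUB_Iic_iff.2
    (exists_local_isLUB (mem_upperBounds_image_val _)
      (Or.inr fun F hF => hX ∅ (Or.inr rfl) F hF (Set.empty_subset _)) hX.isSL)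

theorem IsBc.isBcDomain_closedSet (hX : X.IsBc) : IsBcDomain X.ClosedSet where
  continuousDomain := isContinuousDomain_closedSet
  bcPoset := hX.isBcPoset_closedSet

end CFSpace

/-! ### CF-approximable relations as Scott continuous maps. -/

namespace CFRel

variable {X Y Z : CFSpace.{u}}

/-- The sets `upper G` with `G` related to some member of the family contained in `E`. -/
def images (Θ : CFRel X Y) (E : Set X.carrier) : Set (Set Y.carrier) :=
  {A | ∃ F G, (F.1 : Set X.carrier) ⊆ E ∧ Θ.Rel F G ∧ A = Y.upper G.1}

theorem images_nonempty (Θ : CFRel X Y) {E : Set X.carrier} (hE : CFSpace.IsCFClosed E) :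
    (Θ.images E).Nonempty := by
  obtain ⟨F, hF, -, h⟩ := hE.exists_subset Set.finite_empty (Set.empty_subset _)
  obtain ⟨G, hG⟩ := Θ.total ⟨F, hF⟩
  exact ⟨_, ⟨F, hF⟩, G, h, hG, rfl⟩

theorem images_directedOn (Θ : CFRel X Y) {E : Set X.carrier} (hE : CFSpace.IsCFClosed E) :
    DirectedOn (· ⊆ ·) (Θ.images E) := by
  rintro _ ⟨F, G, hF, hG, rfl⟩ _ ⟨F', G', hF', hG', rfl⟩
  obtain ⟨H, hH, h1, h2⟩ := hE.exists_subset (F.1.finite_toSet.union F'.1.finite_toSet)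
    (Set.union_subset hF hF')
  obtain ⟨K, h3, h4⟩ := Θ.directed ⟨H, hH⟩ G G'
    (Θ.mono_left F ⟨H, hH⟩ G (Set.subset_union_left.trans h1) hG)
    (Θ.mono_left F' ⟨H, hH⟩ G' (Set.subset_union_right.trans h1) hG')
  exact ⟨_, ⟨⟨H, hH⟩, K, h2, h4, rfl⟩,
    CFSpace.upper_subset (Set.subset_union_left.trans h3),
    CFSpace.upper_subset (Set.subset_union_right.trans h3)⟩

/-- The map on CF-closed sets induced by a CF-approximable relation. -/
def map (Θ : CFRel X Y) (E : X.ClosedSet) : Y.ClosedSet :=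
  ⟨⋃₀ Θ.images E.1, CFSpace.IsCFClosed.sUnion (Θ.images_nonempty E.2) (Θ.images_directedOn E.2)
    (by rintro _ ⟨F, G, -, -, rfl⟩; exact CFSpace.isCFClosed_upper G.2)⟩

theorem mem_map {Θ : CFRel X Y} {E : X.ClosedSet} {y : Y.carrier} :
    y ∈ (Θ.map E).1 ↔ ∃ F G, (F.1 : Set X.carrier) ⊆ E.1 ∧ Θ.Rel F G ∧ y ∈ Y.upper G.1 := by
  constructor
  · rintro ⟨_, ⟨F, G, h1, h2, rfl⟩, h3⟩
    exact ⟨F, G, h1, h2, h3⟩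
  · rintro ⟨F, G, h1, h2, h3⟩
    exact ⟨_, ⟨F, G, h1, h2, rfl⟩, h3⟩

/-- A finite `G` in the directed union lies in a single `upper G'`, and `mono_right` applies.
Conversely `G` need not lie in `upper G`, so `interpolate` first supplies a `G'` with `G ⊆ upper
G'`. -/
theorem subset_map_iff {Θ : CFRel X Y} {E : X.ClosedSet} {G : Y.family} :
    (G.1 : Set Y.carrier) ⊆ (Θ.map E).1 ↔
      ∃ F : X.family, (F.1 : Set X.carrier) ⊆ E.1 ∧ Θ.Rel F G := by
  constructor
  · intro h
    obtain ⟨_, ⟨F, G', h1, h2, rfl⟩, h3⟩ :=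
      DirectedOn.exists_mem_subset_of_finset_subset_biUnion (Θ.images_nonempty E.2)
        (f := fun A => A) (Θ.images_directedOn E.2) (by rwa [← Set.sUnion_eq_biUnion])
    exact ⟨F, h1, Θ.mono_right F G' G h2 h3⟩
  · rintro ⟨F, h1, h2⟩ y hy
    obtain ⟨F', G', h3, h4, h5⟩ := Θ.interpolate F G h2
    exact mem_map.2 ⟨F', G', h3.trans (E.2.upper_subset_of_subset h1), h5, h4 hy⟩

/-- The relation is recovered from its map. This gives faithfulness and dictates the definition of
`ofScottContinuous`. -/
theorem subset_map_principal_iff {Θ : CFRel X Y} {F : X.family} {G : Y.family} :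
    (G.1 : Set Y.carrier) ⊆ (Θ.map (CFSpace.principal F)).1 ↔ Θ.Rel F G := by
  rw [subset_map_iff]
  constructor
  · rintro ⟨F', h1, h2⟩
    exact Θ.mono_left F' F G h1 h2
  · intro h
    obtain ⟨F', G', h3, h4, h5⟩ := Θ.interpolate F G h
    exact ⟨F', h3, Θ.mono_right F' G' G h5 h4⟩

theorem map_mono (Θ : CFRel X Y) : Monotone Θ.map := fun E E' h y hy => by
  obtain ⟨F, G, h1, h2, h3⟩ := mem_map.1 hy
  exact mem_map.2 ⟨F, G, h1.trans h, h2, h3⟩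

theorem scottContinuous_map (Θ : CFRel X Y) : ScottContinuous Θ.map := by
  intro D hD hdir E hE
  constructor
  · rintro _ ⟨A, hA, rfl⟩
    exact Θ.map_mono (hE.1 hA)
  · intro B hB y hy
    obtain ⟨F, G, h1, h2, h3⟩ := mem_map.1 hy
    obtain ⟨A, hA, hFA⟩ := CFSpace.exists_subset_of_isLUB hD hdir hE h1
    exact hB ⟨A, hA, rfl⟩ (mem_map.2 ⟨F, G, hFA, h2, h3⟩)

theorem map_id (E : X.ClosedSet) : (CFRel.id X).map E = E := by
  refine CFSpace.closedSet_ext fun G => subset_map_iff.trans ?_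
  constructor
  · rintro ⟨F, h1, h2⟩
    exact h2.trans (E.2.upper_subset_of_subset h1)
  · intro h
    obtain ⟨F, hF, h1, h2⟩ := E.2.exists_subset G.1.finite_toSet h
    exact ⟨⟨F, hF⟩, h2, h1⟩

theorem map_comp (Θ : CFRel X Y) (Υ : CFRel Y Z) (E : X.ClosedSet) :
    (Θ.comp Υ).map E = Υ.map (Θ.map E) := by
  refine CFSpace.closedSet_ext fun G => ?_
  simp only [subset_map_iff]
  constructor
  · rintro ⟨F, h1, H, h2, h3⟩
    exact ⟨H, ⟨F, h1, h2⟩, h3⟩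
  · rintro ⟨H, ⟨F, h1, h2⟩, h3⟩
    exact ⟨F, h1, H, h2, h3⟩

theorem map_injective {Θ Υ : CFRel X Y} (h : Θ.map = Υ.map) : Θ = Υ := by
  ext F G
  rw [← subset_map_principal_iff, h, subset_map_principal_iff]

/-- The CF-approximable relation of a Scott continuous map between CF-closed sets. -/
def ofScottContinuous (f : X.ClosedSet → Y.ClosedSet) (hf : ScottContinuous f) : CFRel X Y where
  Rel F G := (G.1 : Set Y.carrier) ⊆ (f (CFSpace.principal F)).1
  total F := by
    obtain ⟨G, hG, -, h⟩ := (f (CFSpace.principal F)).2.exists_subset Set.finite_empty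
      (Set.empty_subset _)
    exact ⟨⟨G, hG⟩, h⟩
  mono_left F F' G h hG := hG.trans (hf.monotone (CFSpace.principal_le_of_subset h))
  mono_right F G G' hG h := h.trans ((f (CFSpace.principal F)).2.upper_subset_of_subset hG)
  interpolate F G h := by
    obtain ⟨G', hG', h1, h2⟩ := (f (CFSpace.principal F)).2.exists_subset G.1.finite_toSet h
    have hdir := CFSpace.approximants_directedOn (CFSpace.principal F)
    -- `f` preserves the supremum of the approximants of `principal F`, so the finite `G'` already
    -- lies in the image of a single approximant.
    obtain ⟨_, ⟨_, ⟨F', hF', rfl⟩, rfl⟩, h3⟩ := CFSpace.exists_subset_of_isLUB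
      ((CFSpace.approximants_nonempty (CFSpace.principal F)).image f)
      (hdir.mono_comp (g := f) fun _ _ h => hf.monotone h)
      (hf (CFSpace.approximants_nonempty _) hdir (CFSpace.isLUB_approximants _)) h2
    exact ⟨F', ⟨G', hG'⟩, hF', h1, h3⟩
  directed F G₁ G₂ h₁ h₂ := by
    obtain ⟨G, hG, h3, h4⟩ := (f (CFSpace.principal F)).2.exists_subset
      (G₁.1.finite_toSet.union G₂.1.finite_toSet) (Set.union_subset h₁ h₂)
    exact ⟨⟨G, hG⟩, h3, h4⟩

/-- Every `E` is a directed supremum of principal sets, so `f` is determined by its values on these.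
-/
theorem map_ofScottContinuous (f : X.ClosedSet → Y.ClosedSet) (hf : ScottContinuous f) :
    (ofScottContinuous f hf).map = f := by
  funext E
  refine CFSpace.closedSet_ext fun G => subset_map_iff.trans ?_
  have hdir := CFSpace.approximants_directedOn E
  constructor
  · rintro ⟨F, h1, h2⟩
    exact h2.trans (hf.monotone (CFSpace.principal_le_of_subset h1))
  · intro h
    obtain ⟨_, ⟨_, ⟨F, hF, rfl⟩, rfl⟩, h3⟩ := CFSpace.exists_subset_of_isLUB
      ((CFSpace.approximants_nonempty E).image f)
      (hdir.mono_comp (g := f) fun _ _ h => hf.monotone h)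
      (hf (CFSpace.approximants_nonempty _) hdir (CFSpace.isLUB_approximants _)) h
    exact ⟨F, hF, h3⟩

end CFRel

/-! ### The functor and its restriction to full subcategories. -/

/-- The functor sending a CF-approximation space to its dcpo of CF-closed sets. -/
def closedSetFunctor : CFSpace.{u} ⥤ Dcpo.{u} where
  obj X := ⟨X.ClosedSet, CFSpace.isDcpo_closedSet⟩
  map Θ := ⟨CFRel.map Θ, CFRel.scottContinuous_map Θ⟩
  map_id _ := ScottHom.ext (funext CFRel.map_id)
  map_comp Θ Υ := ScottHom.ext (funext (CFRel.map_comp Θ Υ))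

instance : closedSetFunctor.{u}.Faithful where
  map_injective h := CFRel.map_injective (congrArg ScottHom.toFun h)

instance : closedSetFunctor.{u}.Full where
  map_surjective f := ⟨CFRel.ofScottContinuous f.toFun f.scottContinuous,
    ScottHom.ext (CFRel.map_ofScottContinuous f.toFun f.scottContinuous)⟩

/-- An order isomorphism of dcpos is an isomorphism in the category of dcpos. -/
def Dcpo.isoOfOrderIso {L M : Dcpo.{u}} (e : L.carrier ≃o M.carrier) : L ≅ M where
  hom := ⟨e, fun _ _ _ _ h => e.isLUB_image'.2 h⟩
  inv := ⟨e.symm, fun _ _ _ _ h => e.symm.isLUB_image'.2 h⟩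
  hom_inv_id := ScottHom.ext (funext e.symm_apply_apply)
  inv_hom_id := ScottHom.ext (funext e.apply_symm_apply)

/-- A fully faithful functor restricts to an equivalence between full subcategories that it maps
to one another. -/
theorem nonempty_fullSubcategory_equivalence {C D : Type*} [Category C] [Category D] (Φ : C ⥤ D)
    [Φ.Full] [Φ.Faithful] (P : ObjectProperty C) (Q : ObjectProperty D)
    (hPQ : ∀ X, P X → Q (Φ.obj X)) (hQP : ∀ L, Q L → ∃ X, P X ∧ Nonempty (Φ.obj X ≅ L)) :
    Nonempty (P.FullSubcategory ≌ Q.FullSubcategory) := by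
  let Ψ := Q.lift (P.ι ⋙ Φ) fun X => hPQ _ X.property
  have : Ψ.EssSurj := ⟨fun L => by
    obtain ⟨X, hX, ⟨e⟩⟩ := hQP L.obj L.property
    exact ⟨⟨X, hX⟩, ⟨ObjectProperty.isoMk _ e⟩⟩⟩
  have : Ψ.IsEquivalence := { }
  exact ⟨Ψ.asEquivalence⟩

/-! ### Bases of continuous and algebraic domains. -/

section Basis

variable {P : Type u} [PartialOrder P]

theorem WayBelow.le {x y : P} (h : WayBelow x y) : x ≤ y := by
  obtain ⟨d, rfl, hd⟩ := h {y} y (Set.singleton_nonempty y) (directedOn_singleton y)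
    isLUB_singleton le_rfl
  exact hd

theorem WayBelow.trans_le {x y z : P} (h : WayBelow x y) (hyz : y ≤ z) : WayBelow x z :=
  fun D s hD hdir hs hz => h D s hD hdir hs (hyz.trans hz)

theorem WayBelow.of_le {x y z : P} (hxy : x ≤ y) (h : WayBelow y z) : WayBelow x z :=
  fun D s hD hdir hs hz => (h D s hD hdir hs hz).imp fun _ hd => ⟨hd.1, hxy.trans hd.2⟩

/-- A set `B` is a basis if each `{b ∈ B | b ≪ x}` is directed with supremum `x`. -/
structure IsBasis (B : Set P) : Prop where
  nonempty : ∀ x, {b ∈ B | WayBelow b x}.Nonempty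
  directedOn : ∀ x, DirectedOn (· ≤ ·) {b ∈ B | WayBelow b x}
  isLUB : ∀ x, IsLUB {b ∈ B | WayBelow b x} x

theorem IsContinuousDomain.isBasis_univ (h : IsContinuousDomain P) :
    IsBasis (Set.univ : Set P) where
  nonempty x := by simpa using (h.continuous x).1
  directedOn x := by simpa using (h.continuous x).2.1
  isLUB x := by simpa using (h.continuous x).2.2

/-- `IsCompactElement b` unfolds to `WayBelow b b`, so a compact element below `x` is automatically
way below it. -/
theorem sep_isCompactElement_wayBelow (x : P) :
    {b ∈ {b : P | IsCompactElement b} | WayBelow b x} = {b | b ≤ x ∧ IsCompactElement b} :=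
  Set.ext fun _ => ⟨fun h => ⟨h.2.le, h.1⟩, fun h => ⟨h.2, WayBelow.trans_le h.2 h.1⟩⟩

theorem IsAlgebraicDomain.isBasis_isCompactElement (h : IsAlgebraicDomain P) :
    IsBasis {b : P | IsCompactElement b} where
  nonempty x := by simpa only [sep_isCompactElement_wayBelow] using (h.algebraic x).1
  directedOn x := by simpa only [sep_isCompactElement_wayBelow] using (h.algebraic x).2.1
  isLUB x := by simpa only [sep_isCompactElement_wayBelow] using (h.algebraic x).2.2

namespace IsBasis

variable {B : Set P}

theorem exists_wayBelow_wayBelow (hB : IsBasis B) {a x : P} (h : WayBelow a x) :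
    ∃ b ∈ B, WayBelow a b ∧ WayBelow b x := by
  obtain ⟨d, ⟨b, ⟨hbB, hbx⟩, -, hdb⟩, had⟩ := h
    -- Interpolation: the basis elements two way-below steps under `x` are directed with supremum
    -- `x`, so one of them is above `a`.
    {d | ∃ b ∈ {b ∈ B | WayBelow b x}, d ∈ B ∧ WayBelow d b} x
    (by
      obtain ⟨b, hb⟩ := hB.nonempty x
      obtain ⟨d, hd⟩ := hB.nonempty b
      exact ⟨d, b, hb, hd⟩)
    (by
      rintro d ⟨b, hb, hdB, hdb⟩ d' ⟨b', hb', hdB', hdb'⟩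
      obtain ⟨c, hc, hbc, hbc'⟩ := hB.directedOn x b hb b' hb'
      obtain ⟨e, he, h1, h2⟩ := hB.directedOn c d ⟨hdB, hdb.trans_le hbc⟩ d'
        ⟨hdB', hdb'.trans_le hbc'⟩
      exact ⟨e, ⟨c, hc, he⟩, h1, h2⟩)
    (by
      constructor
      · rintro d ⟨b, hb, hd⟩
        exact hd.2.le.trans hb.2.le
      · intro y hy
        exact (hB.isLUB x).2 fun b hb => (hB.isLUB b).2 fun d hd => hy ⟨b, hb, hd⟩)
    le_rfl
  exact ⟨b, hbB, hdb.of_le had, hbx⟩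

theorem exists_forall_wayBelow (hB : IsBasis B) {x : P} (K : Finset P)
    (hK : ∀ k ∈ K, WayBelow k x) :
    ∃ b ∈ B, WayBelow b x ∧ ∀ k ∈ K, WayBelow k b := by
  classical
  induction K using Finset.induction_on with
  | empty =>
    obtain ⟨b, hb⟩ := hB.nonempty x
    exact ⟨b, hb.1, hb.2, by simp⟩
  | insert k K _ ih =>
    obtain ⟨b, hbB, hbx, hb⟩ := ih fun j hj => hK j (Finset.mem_insert_of_mem hj)
    obtain ⟨c, hcB, hkc, hcx⟩ := hB.exists_wayBelow_wayBelow (hK k (Finset.mem_insert_self k K))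
    obtain ⟨d, hd, hbd, hcd⟩ := hB.directedOn x b ⟨hbB, hbx⟩ c ⟨hcB, hcx⟩
    refine ⟨d, hd.1, hd.2, fun j hj => ?_⟩
    rcases Finset.mem_insert.1 hj with rfl | hj
    · exact hkc.trans_le hcd
    · exact (hb j hj).trans_le hbd

theorem le_of_forall_wayBelow (hB : IsBasis B) {x y : P}
    (h : ∀ b ∈ B, WayBelow b x → WayBelow b y) : x ≤ y :=
  (hB.isLUB x).2 fun b hb => (h b hb.1 hb.2).le

end IsBasis

/-- A basis is closed under the suprema of finite sets of basis elements in principal ideals. -/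
def ClosedUnderLocalSups (B : Set P) : Prop :=
  ∀ (M : Finset P) (x g : P), (∀ m ∈ M, m ∈ B) → (∀ m ∈ M, m ≤ g) → g ≤ x →
    (∀ b ≤ x, (∀ m ∈ M, m ≤ b) → g ≤ b) → g ∈ B

theorem closedUnderLocalSups_univ : ClosedUnderLocalSups (Set.univ : Set P) :=
  fun _ _ _ _ _ _ _ => Set.mem_univ _

/-- A compact `b ≤ g` above the finitely many compact members of `M` exists. It is an upper bound
below `x`, so minimality of `g` forces `g = b`. -/
theorem IsAlgebraicDomain.closedUnderLocalSups (h : IsAlgebraicDomain P) :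
    ClosedUnderLocalSups {b : P | IsCompactElement b} := by
  intro M x g hM hMg hgx hmin
  obtain ⟨b, hb, hMb⟩ : ∃ b ∈ {b | b ≤ g ∧ IsCompactElement b}, ∀ m ∈ M, m ≤ b := by
    obtain ⟨b, hb, h1, h2⟩ := h.isBasis_isCompactElement.exists_forall_wayBelow (x := g) M
      fun m hm => WayBelow.trans_le (hM m hm) (hMg m hm)
    exact ⟨b, ⟨h1.le, hb⟩, fun m hm => (h2 m hm).le⟩
  rw [le_antisymm (hmin b (hb.1.trans hgx) hMb) hb.1]
  exact hb.2

theorem IsSLDomain.exists_local_sup (h : IsSLDomain P) (x : P) (M : Finset P) (hM : M.Nonempty)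
    (hMx : ∀ m ∈ M, m ≤ x) :
    ∃ g ≤ x, (∀ m ∈ M, m ≤ g) ∧ ∀ b ≤ x, (∀ m ∈ M, m ≤ b) → g ≤ b := by
  classical
  induction hM using Finset.Nonempty.cons_induction with
  | singleton a => exact ⟨a, by simpa using hMx, by simp, by simp⟩
  | cons a M ha hM ih =>
    obtain ⟨g, hgx, hg, hmin⟩ := ih fun m hm => hMx m (by simp [hm])
    obtain ⟨c, hcx, hc, hcmin⟩ := exists_isLUB_Iic_iff.1
      (h.principalIdeal x ⟨a, hMx a (by simp)⟩ ⟨g, hgx⟩)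
    simp only [Set.image_pair, upperBounds_insert, upperBounds_singleton, Set.mem_inter_iff,
      Set.mem_Ici] at hc hcmin
    simp only [Finset.mem_cons, forall_eq_or_imp]
    exact ⟨c, hcx, ⟨hc.1, fun m hm => (hg m hm).trans hc.2⟩,
      fun b hbx hb => hcmin b hbx ⟨hb.1, hmin b hbx hb.2⟩⟩

theorem IsLDomain.exists_local_sup (h : IsLDomain P) (x : P) (M : Set P)
    (hMx : ∀ m ∈ M, m ≤ x) :
    ∃ g ≤ x, (∀ m ∈ M, m ≤ g) ∧ ∀ b ≤ x, (∀ m ∈ M, m ≤ b) → g ≤ b := by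
  have := exists_isLUB_Iic_iff.1 (h.principalIdeal x (Subtype.val ⁻¹' M))
  rwa [Subtype.image_preimage_coe,
    Set.inter_eq_right.2 (show M ⊆ Set.Iic x from hMx)] at this

/-! ### The approximation space of a basis. -/

theorem mem_upperApprox_singleton {B : Set P} {a x : B} :
    a ∈ upperApprox (fun a b : B => WayBelow a.1 b.1) (({x} : Finset B) : Set B) ↔
      WayBelow a.1 x.1 := by
  constructor
  · rintro ⟨y, hay, hy⟩
    obtain rfl : y = x := by simpa using hy
    exact hay
  · exact fun h => ⟨x, h, by simp⟩

/-- The CF-approximation space of a basis: the relation is the way-below relation and the family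
consists of the singletons. -/
def basisSpace [Nonempty P] (B : Set P) (hB : IsBasis B) : CFSpace.{u} where
  carrier := B
  rel a b := WayBelow a.1 b.1
  trans _ _ _ h h' := h.trans_le h'.le
  family := {F | ∃ b, F = {b}}
  family_nonempty := by
    obtain ⟨b, hb⟩ := hB.nonempty (Classical.arbitrary P)
    exact ⟨_, ⟨b, hb.1⟩, rfl⟩
  consistent := by
    rintro _ ⟨x, rfl⟩ K hK
    obtain ⟨b, hbB, hbx, hb⟩ := hB.exists_forall_wayBelow (x := x.1)
      (K.map (Function.Embedding.subtype _)) (by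
        intro k hk
        obtain ⟨a, ha, rfl⟩ := Finset.mem_map.1 hk
        exact mem_upperApprox_singleton.1 (hK ha))
    refine ⟨{⟨b, hbB⟩}, ⟨_, rfl⟩, fun a ha => ?_, ?_⟩
    · exact mem_upperApprox_singleton.2 (hb a.1 (Finset.mem_map.2 ⟨a, ha, rfl⟩))
    · intro a ha
      obtain rfl : a = ⟨b, hbB⟩ := by simpa using ha
      exact mem_upperApprox_singleton.2 hbx

section BasisSpace

variable [Nonempty P] {B : Set P} {hB : IsBasis B}

theorem mem_upper_singleton {a x : B} :
    a ∈ (basisSpace B hB).upper (({x} : Finset B) : Set B) ↔ WayBelow a.1 x.1 :=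
  mem_upperApprox_singleton

/-- Inclusion of upper approximations is the order of `P` restricted to `B`, so relative suprema in
the space can be read off from local suprema in `P`. -/
theorem upper_singleton_subset_iff {x y : B} :
    (basisSpace B hB).upper (({x} : Finset B) : Set B) ⊆
      (basisSpace B hB).upper (({y} : Finset B) : Set B) ↔ x.1 ≤ y.1 := by
  constructor
  · exact fun h => hB.le_of_forall_wayBelow fun b hb hbx =>
      mem_upper_singleton.1 (h (mem_upper_singleton.2 hbx : (⟨b, hb⟩ : B) ∈ _))
  · exact fun h a ha => mem_upper_singleton.2 ((mem_upper_singleton.1 ha).trans_le h)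

theorem upper_subset_upper_singleton_iff {M : Set B} {x : B} :
    (basisSpace B hB).upper M ⊆ (basisSpace B hB).upper (({x} : Finset B) : Set B) ↔
      ∀ m ∈ M, m.1 ≤ x.1 := by
  constructor
  · exact fun h m hm => upper_singleton_subset_iff.1
      ((CFSpace.upper_mono (by
        rw [Finset.coe_singleton]; exact Set.singleton_subset_iff.2 hm)).trans h)
  · rintro h a ⟨m, ham, hm⟩
    exact mem_upper_singleton.2 (WayBelow.trans_le ham (h m hm))

theorem finite_of_mem_joinSaturation {X : CFSpace.{u}} {M : Set X.carrier}
    (hM : M ∈ X.joinSaturation) : M.Finite := by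
  obtain ⟨𝒢, h1, -, -, rfl⟩ := hM
  exact h1.biUnion fun F _ => F.finite_toSet

theorem nonempty_of_mem_joinSaturation_basisSpace {M : Set B}
    (hM : M ∈ (basisSpace B hB).joinSaturation) : M.Nonempty := by
  obtain ⟨𝒢, -, ⟨F, hF⟩, h3, rfl⟩ := hM
  obtain ⟨b, rfl⟩ := h3 hF
  exact ⟨b, Set.mem_biUnion hF (Finset.mem_coe.2 (Finset.mem_singleton_self b))⟩

theorem relSup_basisSpace_nonempty {M : Set B} {x g : B} (hg : ∀ m ∈ M, m.1 ≤ g.1)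
    (hgx : g.1 ≤ x.1) (hmin : ∀ b ≤ x.1, (∀ m ∈ M, m.1 ≤ b) → g.1 ≤ b) :
    ((basisSpace B hB).relSup M {x}).Nonempty := by
  refine ⟨{g}, ⟨g, rfl⟩, ⟨upper_subset_upper_singleton_iff.2 hg,
    upper_singleton_subset_iff.2 hgx⟩, ?_⟩
  rintro _ ⟨b, rfl⟩ h1 h2
  exact upper_singleton_subset_iff.2 (hmin b.1 (upper_singleton_subset_iff.1 h2)
    (upper_subset_upper_singleton_iff.1 h1))

theorem absSup_basisSpace_nonempty {M : Set B} {x g : B} (hg : ∀ m ∈ M, m.1 ≤ g.1)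
    (hgx : g.1 ≤ x.1) (hmin : ∀ b : P, (∀ m ∈ M, m.1 ≤ b) → g.1 ≤ b) :
    ((basisSpace B hB).absSup M {x}).Nonempty := by
  refine ⟨{g}, ⟨g, rfl⟩, ⟨upper_subset_upper_singleton_iff.2 hg,
    upper_singleton_subset_iff.2 hgx⟩, ?_⟩
  rintro _ ⟨b, rfl⟩ h1
  exact upper_singleton_subset_iff.2 (hmin b.1 (upper_subset_upper_singleton_iff.1 h1))

theorem isSL_basisSpace (hcl : ClosedUnderLocalSups B) (h : IsSLDomain P) :
    (basisSpace B hB).IsSL := by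
  rintro M hM _ ⟨x, rfl⟩ hMx
  obtain ⟨M, rfl⟩ : ∃ N : Finset B, (N : Set B) = M :=
    ⟨_, (finite_of_mem_joinSaturation hM).coe_toFinset⟩
  obtain ⟨g, hgx, hg, hmin⟩ := h.exists_local_sup x.1 (M.map (Function.Embedding.subtype _))
    (by simpa using nonempty_of_mem_joinSaturation_basisSpace hM)
    (by
      intro m hm
      obtain ⟨a, ha, rfl⟩ := Finset.mem_map.1 hm
      exact (mem_upper_singleton.1 (hMx ha)).le)
  -- The supremum is formed in `P`; it yields a member of the family only if it belongs to `B`.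
  have hgB := hcl _ x.1 g (fun _ hm => Finset.property_of_mem_map_subtype M hm) hg hgx hmin
  exact relSup_basisSpace_nonempty (g := ⟨g, hgB⟩)
    (fun m hm => hg m (Finset.mem_map.2 ⟨m, hm, rfl⟩)) hgx
    fun b hbx hb => hmin b hbx (by
      intro m hm
      obtain ⟨a, ha, rfl⟩ := Finset.mem_map.1 hm
      exact hb a ha)

theorem finite_of_mem_joinSaturation_union {X : CFSpace.{u}} {M : Set X.carrier}
    (hM : M ∈ X.joinSaturation ∪ {∅}) : M.Finite := by
  rcases hM with hM | rfl
  · exact finite_of_mem_joinSaturation hM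
  · exact Set.finite_empty

theorem isL_basisSpace (hcl : ClosedUnderLocalSups B) (h : IsLDomain P) :
    (basisSpace B hB).IsL := by
  rintro M hM _ ⟨x, rfl⟩ hMx
  obtain ⟨M, rfl⟩ : ∃ N : Finset B, (N : Set B) = M :=
    ⟨_, (finite_of_mem_joinSaturation_union hM).coe_toFinset⟩
  obtain ⟨g, hgx, hg, hmin⟩ := h.exists_local_sup x.1 (M.map (Function.Embedding.subtype _))
    (by
      intro m hm
      obtain ⟨a, ha, rfl⟩ := Finset.mem_map.1 hm
      exact (mem_upper_singleton.1 (hMx ha)).le)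
  have hgB := hcl _ x.1 g (fun _ hm => Finset.property_of_mem_map_subtype M hm) hg hgx hmin
  exact relSup_basisSpace_nonempty (g := ⟨g, hgB⟩)
    (fun m hm => hg m (Finset.mem_map.2 ⟨m, hm, rfl⟩)) hgx
    fun b hbx hb => hmin b hbx (by
      intro m hm
      obtain ⟨a, ha, rfl⟩ := Finset.mem_map.1 hm
      exact hb a ha)

theorem isBc_basisSpace_univ {hB : IsBasis (Set.univ : Set P)} (h : IsBcDomain P) :
    (basisSpace Set.univ hB).IsBc := by
  rintro M hM _ ⟨x, rfl⟩ hMx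
  have hx : x.1 ∈ upperBounds (Subtype.val '' M) := by
    rintro _ ⟨a, ha, rfl⟩
    exact (mem_upper_singleton.1 (hMx ha)).le
  obtain ⟨g, hg, hmin⟩ := h.bcPoset (Subtype.val '' M) ⟨x.1, hx⟩
  refine absSup_basisSpace_nonempty (g := ⟨g, trivial⟩) (fun m hm => hg ⟨m, hm, rfl⟩) (hmin hx)
    fun b hb => hmin ?_
  rintro _ ⟨a, ha, rfl⟩
  exact hb a ha

theorem isTopological_basisSpace (h : ∀ b ∈ B, IsCompactElement b) :
    (basisSpace B hB).IsTopological :=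
  fun b => h b.1 b.2

/-- The CF-closed set of basis elements way below a point. -/
def wayBelowSet (hB : IsBasis B) (x : P) : (basisSpace B hB).ClosedSet :=
  ⟨{b : B | WayBelow b.1 x}, by
    intro K hK
    obtain ⟨b, hbB, hbx, hb⟩ := hB.exists_forall_wayBelow (x := x)
      (K.map (Function.Embedding.subtype _)) (by
        intro k hk
        obtain ⟨a, ha, rfl⟩ := Finset.mem_map.1 hk
        exact hK ha)
    exact ⟨{⟨b, hbB⟩}, ⟨_, rfl⟩,
      fun a ha => mem_upper_singleton.2 (hb a.1 (Finset.mem_map.2 ⟨a, ha, rfl⟩)),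
      fun a ha => (mem_upper_singleton.1 ha).trans_le hbx.le⟩⟩

theorem wayBelowSet_le_iff {x y : P} : wayBelowSet hB x ≤ wayBelowSet hB y ↔ x ≤ y := by
  constructor
  · exact fun h => hB.le_of_forall_wayBelow fun b hb hbx =>
      show (⟨b, hb⟩ : B) ∈ (wayBelowSet hB y).1 from
        h (show (⟨b, hb⟩ : B) ∈ (wayBelowSet hB x).1 from hbx)
  · exact fun h b hb => WayBelow.trans_le hb h

theorem wayBelowSet_surjective (hP : IsDcpo P) : Function.Surjective (wayBelowSet hB) := by
  intro E
  -- With singletons as family, CF-closed sets are rounded ideals: finite subsets have strict upper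
  -- bounds, in the way-below sense, inside the set.
  have hK : ∀ K : Set B, K.Finite → K ⊆ E.1 → ∃ g ∈ E.1, ∀ a ∈ K, WayBelow a.1 g.1 := by
    intro K hfin hKE
    obtain ⟨_, ⟨g, rfl⟩, h1, h2⟩ := E.2.exists_subset hfin hKE
    exact ⟨g, h2 (Finset.mem_coe.2 (Finset.mem_singleton_self g)),
      fun a ha => mem_upper_singleton.1 (h1 ha)⟩
  have hne : (Subtype.val '' E.1 : Set P).Nonempty := by
    obtain ⟨g, hg, -⟩ := hK ∅ Set.finite_empty (Set.empty_subset _)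
    exact ⟨g.1, g, hg, rfl⟩
  have hdir : DirectedOn (· ≤ ·) (Subtype.val '' E.1 : Set P) := by
    rintro _ ⟨a, ha, rfl⟩ _ ⟨b, hb, rfl⟩
    obtain ⟨g, hg, h⟩ := hK {a, b} (Set.toFinite _) (by
      rintro _ (rfl | rfl)
      exacts [ha, hb])
    exact ⟨g.1, ⟨g, hg, rfl⟩, (h a (Or.inl rfl)).le, (h b (Or.inr rfl)).le⟩
  obtain ⟨s, hs⟩ := hP _ hne hdir
  refine ⟨s, Subtype.ext (Set.ext fun b => ⟨fun hb => ?_, fun hb => ?_⟩)⟩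
  -- Since `b` is way below the supremum of `E`, it lies under some `e` in `E`. Roundedness gives
  -- `g` in `E` with `e`, hence `b`, way below `g`.
  · obtain ⟨_, ⟨e, he, rfl⟩, hbe⟩ := hb _ s hne hdir hs le_rfl
    obtain ⟨g, hg, h⟩ := hK {e} (Set.finite_singleton e)
      (Set.singleton_subset_iff.2 he)
    exact E.2.upper_subset ⟨g, (h e rfl).of_le hbe, hg⟩
  · obtain ⟨g, hg, h⟩ := hK {b} (Set.finite_singleton b)
      (Set.singleton_subset_iff.2 hb)
    exact (h b rfl).trans_le (hs.1 ⟨g, hg, rfl⟩)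

/-- A dcpo with a basis is isomorphic to the poset of CF-closed sets of the basis. -/
noncomputable def closedSetOrderIso (hB : IsBasis B) (hP : IsDcpo P) :
    (basisSpace B hB).ClosedSet ≃o P :=
  (RelIso.ofSurjective (OrderEmbedding.ofMapLEIff (wayBelowSet hB) fun _ _ => wayBelowSet_le_iff)
    (wayBelowSet_surjective hP)).symm

end BasisSpace

end Basis

end RoughDomain

theorem mainTheorem5 :
    Nonempty (RoughDomain.SLApps.{u} ≌ RoughDomain.SLDom.{u}) ∧
    Nonempty (RoughDomain.LApps.{u} ≌ RoughDomain.LDom.{u}) ∧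
    Nonempty (RoughDomain.BcApps.{u} ≌ RoughDomain.BcDom.{u}) ∧
    Nonempty (RoughDomain.TopSLApps.{u} ≌ RoughDomain.AlgSLDom.{u}) ∧
    Nonempty (RoughDomain.TopLApps.{u} ≌ RoughDomain.AlgLDom.{u}) := by
  open RoughDomain in
  refine ⟨nonempty_fullSubcategory_equivalence closedSetFunctor _ _
      (fun X hX => CFSpace.IsSL.isSLDomain_closedSet hX) fun L hL => ?_,
    nonempty_fullSubcategory_equivalence closedSetFunctor _ _
      (fun X hX => CFSpace.IsL.isLDomain_closedSet hX) fun L hL => ?_,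
    nonempty_fullSubcategory_equivalence closedSetFunctor _ _
      (fun X hX => CFSpace.IsBc.isBcDomain_closedSet hX) fun L hL => ?_,
    nonempty_fullSubcategory_equivalence closedSetFunctor _ _
      (fun X hX => ⟨hX.1.isAlgebraicDomain_closedSet, hX.2.isSLDomain_closedSet⟩)
      fun L hL => ?_,
    nonempty_fullSubcategory_equivalence closedSetFunctor _ _
      (fun X hX => ⟨hX.1.isAlgebraicDomain_closedSet, hX.2.isLDomain_closedSet⟩)
      fun L hL => ?_⟩
  -- The whole domain is the basis, so closure under local suprema is automatic.
  · have := hL.continuousDomain.nonempty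
    exact ⟨basisSpace _ hL.continuousDomain.isBasis_univ,
      isSL_basisSpace closedUnderLocalSups_univ hL,
      ⟨Dcpo.isoOfOrderIso (closedSetOrderIso _ L.isDcpo)⟩⟩
  · have := hL.continuousDomain.nonempty
    exact ⟨basisSpace _ hL.continuousDomain.isBasis_univ,
      isL_basisSpace closedUnderLocalSups_univ hL,
      ⟨Dcpo.isoOfOrderIso (closedSetOrderIso _ L.isDcpo)⟩⟩
  · have := hL.continuousDomain.nonempty
    exact ⟨basisSpace _ hL.continuousDomain.isBasis_univ, isBc_basisSpace_univ hL,
      ⟨Dcpo.isoOfOrderIso (closedSetOrderIso _ L.isDcpo)⟩⟩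
  -- The basis of compact elements makes the way-below relation reflexive, hence the space
  -- topological.
  · have := hL.1.nonempty
    exact ⟨basisSpace _ hL.1.isBasis_isCompactElement,
      ⟨isTopological_basisSpace fun _ h => h,
        isSL_basisSpace hL.1.closedUnderLocalSups hL.2⟩,
      ⟨Dcpo.isoOfOrderIso (closedSetOrderIso _ L.isDcpo)⟩⟩
  · have := hL.1.nonempty
    exact ⟨basisSpace _ hL.1.isBasis_isCompactElement,
      ⟨isTopological_basisSpace fun _ h => h,
        isL_basisSpace hL.1.closedUnderLocalSups hL.2⟩,
      ⟨Dcpo.isoOfOrderIso (closedSetOrderIso _ L.isDcpo)⟩⟩
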